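/- Let $\sigma=2$ or $\sigma=3$. A binary quadratic form $Q(x,y)=ax^2+bxy+cy^2$ with $a,b,c\in\mathbb Z$ has discriminant $b^2-4ac$ and is primitive if $\gcd(a,b,c)=1$. For an integer $\Delta$, let $\mathrm{Cl}(\Delta)$ be the group, under Gauss composition, of $SL_2(\mathbb Z)$-equivalence classes $[Q]$ of primitive forms of discriminant $\Delta$ (definite forms of either sign are allowed). A binary quadratic diform is a function $Q(x,y)=ax^2+b\sqrt\sigma\,xy+cy^2$ with $a,b,c\in\mathbb Z$; its discriminant is $\Delta=\sigma(b^2\sigma-4ac)$, and its red and blue restrictions are the integral binary quadratic forms of discriminant $\Delta$ $$Q_{\mathrm{red}}(u,v)=Q(u,v\sqrt\sigma)=au^2+b\sigma uv+c\sigma v^2,\qquad Q_{\mathrm{blue}}(u,v)=Q(u\sqrt\sigma,v)=a\sigma u^2+b\sigma uv+cv^2.$$ For a discriminant $\Delta$ divisible by $\sigma$, define the integral form of discriminant $\Delta$ $$A_\Delta(u,v)=\begin{cases}\sigma u^2-\frac{\Delta}{4\sigma}v^2&\text{if }\Delta/\sigma\equiv0\pmod 4,\\ \sigma u^2+\sigma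 uv-\frac{\Delta-\sigma^2}{4\sigma}v^2&\text{if }\Delta/\sigma\not\equiv0\pmod 4.\end{cases}$$ Theorem. (1) Let $Q(x,y)=ax^2+b\sqrt\sigma\,xy+cy^2$ be a diform of discriminant $\Delta$ such that $a$, $b\sigma$, $c$ are pairwise coprime. Then $Q_{\mathrm{red}}$, $Q_{\mathrm{blue}}$ and $A_\Delta$ are primitive, and $[Q_{\mathrm{red}}]=[A_\Delta]\cdot[Q_{\mathrm{blue}}]$ in $\mathrm{Cl}(\Delta)$. (2) Conversely, let $\sigma\mid\Delta$, let $A_\Delta$ be primitive (so that $[A_\Delta]\in\mathrm{Cl}(\Delta)$), and let $Q_1,Q_2$ be primitive binary quadratic forms of discriminant $\Delta$ with $[Q_1]=[A_\Delta]\cdot[Q_2]$ in $\mathrm{Cl}(\Delta)$. Then there is a diform $Q$ such that $Q_{\mathrm{red}}$ and $Q_{\mathrm{blue}}$ are primitive of discriminant $\Delta$, $[Q_{\mathrm{red}}]=[Q_1]$ and $[Q_{\mathrm{blue}}]=[Q_2]$. -/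

import Mathlib

/-- An integral binary quadratic form `a x² + b x y + c y²`. -/
@[ext]
structure BQF where
  a : ℤ
  b : ℤ
  c : ℤ

namespace BQF

/-- The value `a x² + b x y + c y²`. -/
def eval (f : BQF) (x y : ℤ) : ℤ := f.a * x ^ 2 + f.b * x * y + f.c * y ^ 2

/-- The discriminant `b² - 4ac`. -/
def disc (f : BQF) : ℤ := f.b ^ 2 - 4 * f.a * f.c

/-- A form is primitive if its coefficients have no common divisor. -/
def IsPrimitive (f : BQF) : Prop := Int.gcd (Int.gcd f.a f.b) f.c = 1

/-- Proper equivalence: `g` is obtained from `f` by a substitution in `SL₂(ℤ)`. -/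
def Equivalent (f g : BQF) : Prop :=
  ∃ γ : Matrix.SpecialLinearGroup (Fin 2) ℤ, ∀ x y : ℤ,
    g.eval x y = f.eval (γ.1 0 0 * x + γ.1 0 1 * y) (γ.1 1 0 * x + γ.1 1 1 * y)

theorem equivalent_iff (f g : BQF) : Equivalent f g ↔ ∃ p q r s : ℤ, p * s - q * r = 1 ∧
    g.a = f.a * p ^ 2 + f.b * p * r + f.c * r ^ 2 ∧
    g.b = 2 * f.a * p * q + f.b * (p * s + q * r) + 2 * f.c * r * s ∧
    g.c = f.a * q ^ 2 + f.b * q * s + f.c * s ^ 2 := by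
  constructor
  · rintro ⟨γ, h⟩
    have hd := γ.2
    rw [Matrix.det_fin_two] at hd
    refine ⟨γ.1 0 0, γ.1 0 1, γ.1 1 0, γ.1 1 1, hd, ?_, ?_, ?_⟩
    · have := h 1 0
      simp only [eval] at this
      linear_combination this
    · have h1 := h 1 0
      have h2 := h 0 1
      have h3 := h 1 1
      simp only [eval] at h1 h2 h3
      linear_combination h3 - h1 - h2
    · have := h 0 1
      simp only [eval] at this
      linear_combination this
  · rintro ⟨p, q, r, s, hd, ha, hb, hc⟩
    refine ⟨⟨!![p, q; r, s], by rw [Matrix.det_fin_two]; simpa using hd⟩, fun x y => ?_⟩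
    simp [eval, ha, hb, hc]
    ring

theorem Equivalent.refl (f : BQF) : Equivalent f f :=
  (equivalent_iff _ _).2 ⟨1, 0, 0, 1, by ring, by ring, by ring, by ring⟩

theorem Equivalent.symm {f g : BQF} (h : Equivalent f g) : Equivalent g f := by
  obtain ⟨p, q, r, s, hd, ha, hb, hc⟩ := (equivalent_iff _ _).1 h
  refine (equivalent_iff _ _).2 ⟨s, -q, -r, p, by linear_combination hd, ?_, ?_, ?_⟩ <;>
  rw [ha, hb, hc]
  · linear_combination (-f.a * (p * s - q * r + 1)) * hd
  · linear_combination (-f.b * (p * s - q * r + 1)) * hd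
  · linear_combination (-f.c * (p * s - q * r + 1)) * hd

theorem Equivalent.trans {f g k : BQF} (h : Equivalent f g) (h' : Equivalent g k) :
    Equivalent f k := by
  obtain ⟨p, q, r, s, hd, ha, hb, hc⟩ := (equivalent_iff _ _).1 h
  obtain ⟨p', q', r', s', hd', ha', hb', hc'⟩ := (equivalent_iff _ _).1 h'
  refine (equivalent_iff _ _).2 ⟨p * p' + q * r', p * q' + q * s', r * p' + s * r',
    r * q' + s * s', by linear_combination (p' * s' - q' * r') * hd + hd', ?_, ?_, ?_⟩
  · rw [ha', ha, hb, hc]; ring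
  · rw [hb', ha, hb, hc]; ring
  · rw [hc', ha, hb, hc]; ring

theorem Equivalent.disc_eq {f g : BQF} (h : Equivalent f g) : g.disc = f.disc := by
  obtain ⟨p, q, r, s, hd, ha, hb, hc⟩ := (equivalent_iff _ _).1 h
  simp only [disc]
  rw [ha, hb, hc]
  linear_combination ((f.b ^ 2 - 4 * f.a * f.c) * (p * s - q * r + 1)) * hd

theorem isPrimitive_iff (f : BQF) : f.IsPrimitive ↔
    ∃ u v w : ℤ, u * f.a + v * f.b + w * f.c = 1 := by
  constructor
  · intro h
    have h1 := Int.gcd_eq_gcd_ab f.a f.b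
    have h2 := Int.gcd_eq_gcd_ab (Int.gcd f.a f.b) f.c
    unfold IsPrimitive at h
    rw [h] at h2
    refine ⟨f.a.gcdA f.b * (Int.gcdA (Int.gcd f.a f.b) f.c),
      f.a.gcdB f.b * (Int.gcdA (Int.gcd f.a f.b) f.c), Int.gcdB (Int.gcd f.a f.b) f.c, ?_⟩
    push_cast at h2
    linear_combination (-Int.gcdA (Int.gcd f.a f.b) f.c) * h1 - h2
  · rintro ⟨u, v, w, h⟩
    have hd : ((Int.gcd (Int.gcd f.a f.b) f.c : ℕ) : ℤ) ∣ 1 := by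
      rw [← h]
      have h1 : ((Int.gcd (Int.gcd f.a f.b) f.c : ℕ) : ℤ) ∣ (Int.gcd f.a f.b : ℕ) :=
        Int.gcd_dvd_left _ _
      exact dvd_add (dvd_add ((h1.trans (Int.gcd_dvd_left _ _)).mul_left _)
        ((h1.trans (Int.gcd_dvd_right _ _)).mul_left _)) ((Int.gcd_dvd_right _ _).mul_left _)
    have := Int.natAbs_dvd_natAbs.2 hd
    simpa [IsPrimitive] using this

theorem isPrimitive_iff_prime (f : BQF) : f.IsPrimitive ↔
    ∀ p : ℕ, p.Prime → (p : ℤ) ∣ f.a → (p : ℤ) ∣ f.b → ¬ (p : ℤ) ∣ f.c := by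
  constructor
  · intro h p hp ha hb hc
    obtain ⟨u, v, w, h⟩ := (isPrimitive_iff f).1 h
    have : (p : ℤ) ∣ 1 := by
      rw [← h]
      exact dvd_add (dvd_add (ha.mul_left _) (hb.mul_left _)) (hc.mul_left _)
    exact hp.one_lt.ne' (by exact_mod_cast Int.eq_one_of_dvd_one (by positivity) this)
  · intro h
    by_contra hne
    obtain ⟨p, hp, hd⟩ := Nat.exists_prime_and_dvd hne
    have hd' : (p : ℤ) ∣ (Int.gcd (Int.gcd f.a f.b) f.c : ℕ) := by exact_mod_cast hd
    have h1 : ((Int.gcd (Int.gcd f.a f.b) f.c : ℕ) : ℤ) ∣ (Int.gcd f.a f.b : ℕ) :=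
      Int.gcd_dvd_left _ _
    exact h p hp ((hd'.trans h1).trans (Int.gcd_dvd_left _ _))
      ((hd'.trans h1).trans (Int.gcd_dvd_right _ _)) (hd'.trans (Int.gcd_dvd_right _ _))

theorem Equivalent.isPrimitive {f g : BQF} (h : Equivalent f g) (hf : f.IsPrimitive) :
    g.IsPrimitive := by
  obtain ⟨p, q, r, s, hd, ha, hb, hc⟩ := (equivalent_iff _ _).1 h.symm
  obtain ⟨u, v, w, h1⟩ := (isPrimitive_iff f).1 hf
  rw [ha, hb, hc] at h1
  refine (isPrimitive_iff g).2 ⟨u * p ^ 2 + v * (2 * p * q) + w * q ^ 2,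
    u * (p * r) + v * (p * s + q * r) + w * (q * s),
    u * r ^ 2 + v * (2 * r * s) + w * s ^ 2, ?_⟩
  linear_combination h1

/-- The substitution `x ↦ x + t y`. -/
theorem equivalent_shift (f : BQF) (t : ℤ) :
    Equivalent f ⟨f.a, f.b + 2 * f.a * t, f.a * t ^ 2 + f.b * t + f.c⟩ :=
  (equivalent_iff _ _).2 ⟨1, t, 0, 1, by ring, by ring, by ring, by ring⟩

/-- The substitution `(x, y) ↦ (-y, x)`. -/
theorem equivalent_flip (f : BQF) : Equivalent f ⟨f.c, -f.b, f.a⟩ :=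
  (equivalent_iff _ _).2 ⟨0, -1, 1, 0, by ring, by ring, by ring, by ring⟩

/-- A primitive form properly represents a number coprime to any given nonzero number. -/
theorem exists_coprime_rep (f : BQF) (hf : f.IsPrimitive) (n : ℤ) (hn : n ≠ 0) :
    ∃ g : BQF, Equivalent f g ∧ IsCoprime g.a n := by
  classical
  set S := n.natAbs.primeFactors with hS
  set X : ℕ := ∏ p ∈ S.filter (fun p : ℕ => (p : ℤ) ∣ f.a ∧ ¬ (p : ℤ) ∣ f.c), p with hX
  set Y : ℕ := ∏ p ∈ S.filter (fun p : ℕ => ¬ (p : ℤ) ∣ f.a), p with hY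
  have hpS : ∀ p ∈ S, p.Prime := fun p hp => Nat.prime_of_mem_primeFactors hp
  have key : ∀ (P : ℕ → Prop) [DecidablePred P] (q : ℕ), q.Prime →
      (q ∣ ∏ p ∈ S.filter P, p ↔ q ∈ S ∧ P q) := by
    intro P _ q hq
    rw [Prime.dvd_finsetProd_iff hq.prime]
    constructor
    · rintro ⟨p, hp, hqp⟩
      rw [Finset.mem_filter] at hp
      have := (Nat.prime_dvd_prime_iff_eq hq (hpS p hp.1)).1 hqp
      subst this
      exact hp
    · rintro h
      exact ⟨q, Finset.mem_filter.2 h, dvd_rfl⟩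
  have hcop : IsCoprime (X : ℤ) (Y : ℤ) := by
    rw [Nat.isCoprime_iff_coprime]
    refine Nat.Coprime.symm (Nat.coprime_of_dvd ?_)
    intro q hq h1 h2
    exact ((key _ q hq).1 h1).2 ((key _ q hq).1 h2).2.1
  obtain ⟨u, v, huv⟩ := hcop
  refine ⟨⟨f.a * X ^ 2 + f.b * X * Y + f.c * Y ^ 2,
    2 * f.a * X * (-v) + f.b * (X * u + (-v) * Y) + 2 * f.c * Y * u,
    f.a * (-v) ^ 2 + f.b * (-v) * u + f.c * u ^ 2⟩,
    (equivalent_iff _ _).2 ⟨X, -v, Y, u, by linear_combination huv, rfl, rfl, rfl⟩, ?_⟩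
  rw [Int.isCoprime_iff_gcd_eq_one]
  by_contra hne
  obtain ⟨q, hq, hqd⟩ := Nat.exists_prime_and_dvd hne
  have hqd' : (q : ℤ) ∣ ((Int.gcd (f.a * X ^ 2 + f.b * X * Y + f.c * Y ^ 2) n : ℕ) : ℤ) := by
    exact_mod_cast hqd
  have h1 := hqd'.trans (Int.gcd_dvd_left _ _)
  have h2 := hqd'.trans (Int.gcd_dvd_right _ _)
  have hqS : q ∈ S := by
    rw [hS, Nat.mem_primeFactors]
    exact ⟨hq, Int.natCast_dvd.1 h2, by simpa using hn⟩
  have hqZ : Prime (q : ℤ) := Nat.prime_iff_prime_int.1 hq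
  have hXd : (q : ℤ) ∣ X ↔ (q : ℤ) ∣ f.a ∧ ¬ (q : ℤ) ∣ f.c := by
    rw [Int.natCast_dvd_natCast, hX, key _ q hq]; simp [hqS]
  have hYd : (q : ℤ) ∣ Y ↔ ¬ (q : ℤ) ∣ f.a := by
    rw [Int.natCast_dvd_natCast, hY, key _ q hq]; simp [hqS]
  by_cases ha : (q : ℤ) ∣ f.a
  · have hY' : ¬ (q : ℤ) ∣ Y := by rw [hYd]; simpa using ha
    by_cases hc : (q : ℤ) ∣ f.c
    · have hX' : ¬ (q : ℤ) ∣ X := by rw [hXd]; tauto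
      have hb : ¬ (q : ℤ) ∣ f.b := fun hb => (isPrimitive_iff_prime f).1 hf q hq ha hb hc
      have : (q : ℤ) ∣ f.b * X * Y := by
        have := dvd_sub (dvd_sub h1 (ha.mul_right ((X : ℤ) ^ 2))) (hc.mul_right ((Y : ℤ) ^ 2))
        rwa [show f.a * X ^ 2 + f.b * X * Y + f.c * Y ^ 2 - f.a * X ^ 2 - f.c * Y ^ 2 =
          f.b * X * Y by ring] at this
      rcases hqZ.dvd_or_dvd this with h | h
      · rcases hqZ.dvd_or_dvd h with h | h
        · exact hb h
        · exact hX' h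
      · exact hY' h
    · have hX' : (q : ℤ) ∣ X := hXd.2 ⟨ha, hc⟩
      have : (q : ℤ) ∣ f.c * Y ^ 2 := by
        have := dvd_sub h1 (hX'.mul_right (f.a * X + f.b * Y))
        rwa [show f.a * X ^ 2 + f.b * X * Y + f.c * Y ^ 2 - X * (f.a * X + f.b * Y) =
          f.c * Y ^ 2 by ring] at this
      rcases hqZ.dvd_or_dvd this with h | h
      · exact hc h
      · exact hY' (hqZ.dvd_of_dvd_pow h)
  · have hY' : (q : ℤ) ∣ Y := hYd.2 ha
    have hX' : ¬ (q : ℤ) ∣ X := by rw [hXd]; tauto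
    have : (q : ℤ) ∣ f.a * X ^ 2 := by
      have := dvd_sub h1 (hY'.mul_right (f.b * X + f.c * Y))
      rwa [show f.a * X ^ 2 + f.b * X * Y + f.c * Y ^ 2 - Y * (f.b * X + f.c * Y) =
        f.a * X ^ 2 by ring] at this
    rcases hqZ.dvd_or_dvd this with h | h
    · exact ha h
    · exact hX' (hqZ.dvd_of_dvd_pow h)

end BQF

/-- A primitive binary quadratic form of discriminant `Δ`. -/
structure PrimForm (Δ : ℤ) where
  form : BQF
  disc_eq : form.disc = Δ
  prim : form.IsPrimitive

instance PrimForm.setoid (Δ : ℤ) : Setoid (PrimForm Δ) where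
  r f g := BQF.Equivalent f.form g.form
  iseqv := ⟨fun f => BQF.Equivalent.refl f.form, fun h => BQF.Equivalent.symm h,
    fun h h' => BQF.Equivalent.trans h h'⟩

/-- The set `Cl(Δ)` of `SL₂(ℤ)`-classes of primitive forms of discriminant `Δ` (definite forms of
either sign are allowed). -/
def FormClass (Δ : ℤ) : Type := Quotient (PrimForm.setoid Δ)

/-- The class `[f]` in `Cl(Δ)` of a primitive form `f` of discriminant `Δ`. -/
def FormClass.mk {Δ : ℤ} (f : BQF) (hd : f.disc = Δ) (hp : f.IsPrimitive) : FormClass Δ :=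
  Quotient.mk (PrimForm.setoid Δ) ⟨f, hd, hp⟩

/-- A `2 × 2 × 2` cube of integers, with front face `(a b; c d)` and back face `(e f; g h)`. -/
structure Cube where
  a : ℤ
  b : ℤ
  c : ℤ
  d : ℤ
  e : ℤ
  f : ℤ
  g : ℤ
  h : ℤ

namespace Cube

/-- The form `-det (M x - N y)` for `M = (m₁ m₂; m₃ m₄)` and `N = (n₁ n₂; n₃ n₄)`. -/
def sliceForm (m₁ m₂ m₃ m₄ n₁ n₂ n₃ n₄ : ℤ) : BQF :=
  ⟨-(m₁ * m₄ - m₂ * m₃), m₁ * n₄ + n₁ * m₄ - m₂ * n₃ - n₂ * m₃, -(n₁ * n₄ - n₂ * n₃)⟩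

theorem eval_sliceForm (m₁ m₂ m₃ m₄ n₁ n₂ n₃ n₄ x y : ℤ) :
    (sliceForm m₁ m₂ m₃ m₄ n₁ n₂ n₃ n₄).eval x y =
      -Matrix.det (x • !![m₁, m₂; m₃, m₄] - y • !![n₁, n₂; n₃, n₄]) := by
  rw [Matrix.det_fin_two]
  simp [sliceForm, BQF.eval]
  ring

/-- The form attached to the front/back slicing `(a b; c d)`, `(e f; g h)`. -/
def Q₁ (A : Cube) : BQF := sliceForm A.a A.b A.c A.d A.e A.f A.g A.h
/-- The form attached to the left/right slicing `(a c; e g)`, `(b d; f h)`. -/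
def Q₂ (A : Cube) : BQF := sliceForm A.a A.c A.e A.g A.b A.d A.f A.h
/-- The form attached to the top/bottom slicing `(a e; b f)`, `(c g; d h)`. -/
def Q₃ (A : Cube) : BQF := sliceForm A.a A.e A.b A.f A.c A.g A.d A.h

theorem exists_replace_Q₁ (A : Cube) {f : BQF} (hf : BQF.Equivalent A.Q₁ f) :
    ∃ A' : Cube, A'.Q₁ = f ∧ A'.Q₂ = A.Q₂ ∧ A'.Q₃ = A.Q₃ := by
  obtain ⟨p, q, r, s, hd, ha, hb, hc⟩ := (BQF.equivalent_iff _ _).1 hf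
  refine ⟨⟨p * A.a - r * A.e, p * A.b - r * A.f, p * A.c - r * A.g, p * A.d - r * A.h,
    -q * A.a + s * A.e, -q * A.b + s * A.f, -q * A.c + s * A.g, -q * A.d + s * A.h⟩, ?_, ?_, ?_⟩
  · ext
    · rw [ha]; simp only [Q₁, sliceForm]; ring
    · rw [hb]; simp only [Q₁, sliceForm]; ring
    · rw [hc]; simp only [Q₁, sliceForm]; ring
  · ext
    · have := congrArg (· * A.Q₂.a) hd
      simp only [Q₂, sliceForm] at this ⊢; linear_combination this
    · have := congrArg (· * A.Q₂.b) hd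
      simp only [Q₂, sliceForm] at this ⊢; linear_combination this
    · have := congrArg (· * A.Q₂.c) hd
      simp only [Q₂, sliceForm] at this ⊢; linear_combination this
  · ext
    · have := congrArg (· * A.Q₃.a) hd
      simp only [Q₃, sliceForm] at this ⊢; linear_combination this
    · have := congrArg (· * A.Q₃.b) hd
      simp only [Q₃, sliceForm] at this ⊢; linear_combination this
    · have := congrArg (· * A.Q₃.c) hd
      simp only [Q₃, sliceForm] at this ⊢; linear_combination this

theorem exists_replace_Q₂ (A : Cube) {f : BQF} (hf : BQF.Equivalent A.Q₂ f) :
    ∃ A' : Cube, A'.Q₁ = A.Q₁ ∧ A'.Q₂ = f ∧ A'.Q₃ = A.Q₃ := by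
  obtain ⟨B, h1, h2, h3⟩ := exists_replace_Q₁ ⟨A.a, A.c, A.e, A.g, A.b, A.d, A.f, A.h⟩
    (f := f) hf
  exact ⟨⟨B.a, B.e, B.b, B.f, B.c, B.g, B.d, B.h⟩, h3, h1, h2⟩

/-- The first two forms of a cube, one of them primitive, determine the class of the third. -/
theorem equivalent_Q₃ (A A' : Cube) (h₁ : A.Q₁ = A'.Q₁) (h₂ : A.Q₂ = A'.Q₂)
    (hp : A.Q₁.IsPrimitive) : BQF.Equivalent A.Q₃ A'.Q₃ := by
  obtain ⟨u, v, w, huvw⟩ := (BQF.isPrimitive_iff _).1 hp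
  obtain ⟨x1, x2, y1, y2, x3, x4, y3, y4⟩ := A
  obtain ⟨X1, X2, Y1, Y2, X3, X4, Y3, Y4⟩ := A'
  simp only [Q₁, Q₂, sliceForm, BQF.mk.injEq] at h₁ h₂ huvw
  obtain ⟨h12, h14a, h34⟩ := h₁
  obtain ⟨h13, h14b, h24⟩ := h₂
  have m12 : x1 * y2 - x2 * y1 = X1 * Y2 - X2 * Y1 := by linear_combination -h12
  have m34 : x3 * y4 - x4 * y3 = X3 * Y4 - X4 * Y3 := by linear_combination -h34
  have m13 : x1 * y3 - x3 * y1 = X1 * Y3 - X3 * Y1 := by linear_combination -h13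
  have m24 : x2 * y4 - x4 * y2 = X2 * Y4 - X4 * Y2 := by linear_combination -h24
  have m14 : x1 * y4 - x4 * y1 = X1 * Y4 - X4 * Y1 := by
    have : 2 * (x1 * y4 - x4 * y1) = 2 * (X1 * Y4 - X4 * Y1) := by
      linear_combination h14a + h14b
    omega
  have m23 : x2 * y3 - x3 * y2 = X2 * Y3 - X3 * Y2 := by linear_combination m14 - h14a
  have hu : -u * (x1 * y2 - x2 * y1) + v * (x1 * y4 - x4 * y1) - v * (x2 * y3 - x3 * y2)
      - w * (x3 * y4 - x4 * y3) = 1 := by linear_combination huvw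
  have hU : -u * (X1 * Y2 - X2 * Y1) + v * (X1 * Y4 - X4 * Y1) - v * (X2 * Y3 - X3 * Y2)
      - w * (X3 * Y4 - X4 * Y3) = 1 := by
    rw [← m12, ← m14, ← m23, ← m34]; exact hu
  obtain ⟨p, hpd⟩ : ∃ p, p = -u * (X1 * y2 - X2 * y1) + v * (X1 * y4 - X4 * y1)
    - v * (X2 * y3 - X3 * y2) - w * (X3 * y4 - X4 * y3) := ⟨_, rfl⟩
  obtain ⟨q, hqd⟩ : ∃ q, q = -u * (-X1 * x2 + X2 * x1) + v * (-X1 * x4 + X4 * x1)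
    - v * (-X2 * x3 + X3 * x2) - w * (-X3 * x4 + X4 * x3) := ⟨_, rfl⟩
  obtain ⟨r, hrd⟩ : ∃ r, r = -u * (Y1 * y2 - Y2 * y1) + v * (Y1 * y4 - Y4 * y1)
    - v * (Y2 * y3 - Y3 * y2) - w * (Y3 * y4 - Y4 * y3) := ⟨_, rfl⟩
  obtain ⟨s, hsd⟩ : ∃ s, s = -u * (-Y1 * x2 + Y2 * x1) + v * (-Y1 * x4 + Y4 * x1)
    - v * (-Y2 * x3 + Y3 * x2) - w * (-Y3 * x4 + Y4 * x3) := ⟨_, rfl⟩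
  have key : ∀ x y X Y : ℤ, x * y1 - x1 * y = X * Y1 - X1 * Y → x * y2 - x2 * y = X * Y2 - X2 * Y →
      x * y3 - x3 * y = X * Y3 - X3 * Y → x * y4 - x4 * y = X * Y4 - X4 * Y →
      p * x + q * y = X ∧ r * x + s * y = Y := by
    intro x y X Y k1 k2 k3 k4
    constructor
    · rw [hpd, hqd]
      linear_combination X * hU + (-u) * (X1 * k2 - X2 * k1) + v * (X1 * k4 - X4 * k1)
        - v * (X2 * k3 - X3 * k2) - w * (X3 * k4 - X4 * k3)
    · rw [hrd, hsd]
      linear_combination Y * hU + (-u) * (Y1 * k2 - Y2 * k1) + v * (Y1 * k4 - Y4 * k1)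
        - v * (Y2 * k3 - Y3 * k2) - w * (Y3 * k4 - Y4 * k3)
  obtain ⟨e1, f1⟩ := key x1 y1 X1 Y1 (by ring) m12 m13 m14
  obtain ⟨e2, f2⟩ := key x2 y2 X2 Y2 (by linear_combination -m12) (by ring) m23 m24
  obtain ⟨e3, f3⟩ := key x3 y3 X3 Y3 (by linear_combination -m13) (by linear_combination -m23)
    (by ring) m34
  obtain ⟨e4, f4⟩ := key x4 y4 X4 Y4 (by linear_combination -m14) (by linear_combination -m24)
    (by linear_combination -m34) (by ring)
  clear key hpd hqd hrd hsd
  have hdet : p * s - q * r = 1 := by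
    rw [← e1, ← e2, ← e3, ← e4, ← f1, ← f2, ← f3, ← f4] at hU
    linear_combination hU - (p * s - q * r) * hu
  refine (BQF.equivalent_iff _ _).2 ⟨p, -r, -q, s, by linear_combination hdet, ?_, ?_, ?_⟩ <;>
  simp only [Q₃, sliceForm] <;>
  simp only [← e1, ← e2, ← e3, ← e4, ← f1, ← f2, ← f3, ← f4] <;>
  ring

end Cube

namespace FormClass

variable {Δ : ℤ}

theorem mk_eq_mk {f g : BQF} {hf : f.disc = Δ} {hf' : f.IsPrimitive} {hg : g.disc = Δ}
    {hg' : g.IsPrimitive} : mk f hf hf' = mk g hg hg' ↔ BQF.Equivalent f g :=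
  Quotient.eq (r := PrimForm.setoid Δ)

theorem mk_eq_of_equivalent {f g : BQF} (hf : f.disc = Δ) (hf' : f.IsPrimitive)
    (h : BQF.Equivalent f g) : mk f hf hf' = mk g (h.disc_eq.trans hf) (h.isPrimitive hf') :=
  mk_eq_mk.2 h

theorem exists_rep (C : FormClass Δ) : ∃ f hf hf', C = mk f hf hf' := by
  induction C using Quotient.inductionOn with
  | h f => exact ⟨f.form, f.disc_eq, f.prim, rfl⟩

/-- Three classes form a triple if they are the classes of the three forms of a cube. -/
def IsTriple (C D E : FormClass Δ) : Prop :=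
  ∃ (A : Cube) (h₁ : A.Q₁.disc = Δ) (h₁' : A.Q₁.IsPrimitive) (h₂ : A.Q₂.disc = Δ)
    (h₂' : A.Q₂.IsPrimitive) (h₃ : A.Q₃.disc = Δ) (h₃' : A.Q₃.IsPrimitive),
    mk A.Q₁ h₁ h₁' = C ∧ mk A.Q₂ h₂ h₂' = D ∧ mk A.Q₃ h₃ h₃' = E

theorem IsTriple.unique {C D E E' : FormClass Δ} (h : IsTriple C D E) (h' : IsTriple C D E') :
    E = E' := by
  obtain ⟨A, a1, a1', a2, a2', a3, a3', rfl, rfl, rfl⟩ := h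
  obtain ⟨A', b1, b1', b2, b2', b3, b3', e1, e2, rfl⟩ := h'
  obtain ⟨B, hB1, hB2, hB3⟩ := A'.exists_replace_Q₁ (mk_eq_mk.1 e1)
  obtain ⟨B', hB1', hB2', hB3'⟩ := B.exists_replace_Q₂ (f := A.Q₂) (by rw [hB2]; exact mk_eq_mk.1 e2)
  refine mk_eq_mk.2 ?_
  rw [← hB3, ← hB3']
  exact A.equivalent_Q₃ B' (by rw [hB1', hB1]) hB2'.symm a1'

theorem coeff_dirichlet {a₁ a₂ B C : ℤ}
    (h₁ : (⟨a₁, B, a₂ * C⟩ : BQF).IsPrimitive) (h₂ : (⟨a₂, B, a₁ * C⟩ : BQF).IsPrimitive) :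
    (⟨a₁ * a₂, B, C⟩ : BQF).IsPrimitive := by
  rw [BQF.isPrimitive_iff_prime] at *
  intro p hp ha hb hc
  rcases (Nat.prime_iff_prime_int.1 hp).dvd_or_dvd ha with h | h
  · exact h₁ p hp h hb (hc.mul_left _)
  · exact h₂ p hp h hb (hc.mul_left _)

theorem isPrimitive_neg {f : BQF} (h : f.IsPrimitive) : (⟨f.a, -f.b, f.c⟩ : BQF).IsPrimitive := by
  simpa [BQF.IsPrimitive] using h

/-- The inverse of the class of `(a, b, c)` is the class of `(a, -b, c)`. -/
instance : Inv (FormClass Δ) where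
  inv := Quotient.map (fun f : PrimForm Δ => ⟨⟨f.form.a, -f.form.b, f.form.c⟩,
      by simpa [BQF.disc] using f.disc_eq, isPrimitive_neg f.prim⟩) (by
    intro f g h
    obtain ⟨p, q, r, s, hd, ha, hb, hc⟩ := (BQF.equivalent_iff _ _).1 h
    refine (BQF.equivalent_iff _ _).2 ⟨p, -q, -r, s, by linear_combination hd, ?_, ?_, ?_⟩ <;>
    simp only [ha, hb, hc] <;> ring)

theorem inv_mk {f : BQF} (hf : f.disc = Δ) (hf' : f.IsPrimitive) :
    (mk f hf hf')⁻¹ = mk ⟨f.a, -f.b, f.c⟩ (by rw [← hf]; simp [BQF.disc]) (isPrimitive_neg hf') :=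
  rfl

theorem inv_inv' (C : FormClass Δ) : C⁻¹⁻¹ = C := by
  obtain ⟨f, hf, hf', rfl⟩ := exists_rep C
  rw [inv_mk, inv_mk]
  exact mk_eq_mk.2 (by simpa using BQF.Equivalent.refl f)

theorem isTriple_dirichlet {a₁ a₂ B C : ℤ}
    (d₁ : (⟨a₁, B, a₂ * C⟩ : BQF).disc = Δ) (h₁ : (⟨a₁, B, a₂ * C⟩ : BQF).IsPrimitive)
    (d₂ : (⟨a₂, B, a₁ * C⟩ : BQF).disc = Δ) (h₂ : (⟨a₂, B, a₁ * C⟩ : BQF).IsPrimitive)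
    (d₃ : (⟨a₁ * a₂, B, C⟩ : BQF).disc = Δ) :
    IsTriple (mk _ d₁ h₁) (mk _ d₂ h₂) (mk _ d₃ (coeff_dirichlet h₁ h₂))⁻¹ := by
  have e1 : (⟨0, a₁, 1, 0, a₂, -B, 0, -C⟩ : Cube).Q₁ = ⟨a₁, B, a₂ * C⟩ := by
    simp [Cube.Q₁, Cube.sliceForm]
  have e2 : (⟨0, a₁, 1, 0, a₂, -B, 0, -C⟩ : Cube).Q₂ = ⟨a₂, B, a₁ * C⟩ := by
    simp [Cube.Q₂, Cube.sliceForm]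
  have e3 : (⟨0, a₁, 1, 0, a₂, -B, 0, -C⟩ : Cube).Q₃ = ⟨a₁ * a₂, -B, C⟩ := by
    simp [Cube.Q₃, Cube.sliceForm, mul_comm]
  rw [inv_mk]
  refine ⟨⟨0, a₁, 1, 0, a₂, -B, 0, -C⟩, by rw [e1]; exact d₁, by rw [e1]; exact h₁,
    by rw [e2]; exact d₂, by rw [e2]; exact h₂, ?_, ?_, ?_, ?_, ?_⟩
  · rw [e3, ← d₃]; simp [BQF.disc]
  · rw [e3]; exact isPrimitive_neg (coeff_dirichlet h₁ h₂)
  · simp only [e1]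
  · simp only [e2]
  · simp only [e3]

theorem exists_rep_coprime (C : FormClass Δ) (n : ℤ) (hn : n ≠ 0) :
    ∃ f hf hf', C = mk f hf hf' ∧ IsCoprime f.a n := by
  obtain ⟨f, hf, hf', rfl⟩ := exists_rep C
  obtain ⟨g, hg, hgn⟩ := f.exists_coprime_rep hf' n hn
  exact ⟨g, hg.disc_eq.trans hf, hg.isPrimitive hf', mk_eq_mk.2 hg, hgn⟩

theorem exists_crt {a b c x y z : ℤ} (hab : IsCoprime a b) (hac : IsCoprime a c)
    (hbc : IsCoprime b c) : ∃ t r s w, t = x + a * r ∧ t = y + b * s ∧ t = z + c * w := by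
  obtain ⟨u, v, huv⟩ := hab
  obtain ⟨u', v', huv'⟩ := hac.mul_left hbc
  refine ⟨(x + a * u * (y - x)) + a * b * u' * (z - (x + a * u * (y - x))), u * (y - x) + b * u' *
    (z - (x + a * u * (y - x))), v * (x - y) + a * u' * (z - (x + a * u * (y - x))),
    v' * ((x + a * u * (y - x)) - z), by ring, ?_, ?_⟩
  · linear_combination (y - x) * huv
  · linear_combination (z - (x + a * u * (y - x))) * huv'

/-- Any three classes contain forms with a common middle coefficient that can be composed. -/
theorem exists_concordant (C₁ C₂ C₃ : FormClass Δ) : ∃ a₁ a₂ a₃ B C : ℤ, ∃ d₁ h₁ d₂ h₂ d₃ h₃,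
    C₁ = mk ⟨a₁, B, a₂ * a₃ * C⟩ d₁ h₁ ∧ C₂ = mk ⟨a₂, B, a₁ * a₃ * C⟩ d₂ h₂ ∧
    C₃ = mk ⟨a₃, B, a₁ * a₂ * C⟩ d₃ h₃ := by
  have ne : ∀ a n : ℤ, IsCoprime a (2 * n) → a ≠ 0 := by
    rintro a n h rfl
    rw [isCoprime_zero_left, Int.isUnit_iff] at h
    omega
  obtain ⟨f₁, d₁, p₁, rfl, c₁⟩ := exists_rep_coprime C₁ (2 * 1) (by norm_num)
  have n₁ := ne _ _ c₁
  obtain ⟨f₂, d₂, p₂, rfl, c₂⟩ := exists_rep_coprime C₂ (2 * f₁.a) (by simpa using n₁)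
  have n₂ := ne _ _ c₂
  obtain ⟨f₃, d₃, p₃, rfl, c₃⟩ := exists_rep_coprime C₃ (2 * (f₁.a * f₂.a)) (by simp [n₁, n₂])
  have n₃ := ne _ _ c₃
  have k12 : IsCoprime f₁.a f₂.a := c₂.of_mul_right_right.symm
  have k13 : IsCoprime f₁.a f₃.a := c₃.of_mul_right_right.of_mul_right_left.symm
  have k23 : IsCoprime f₂.a f₃.a := c₃.of_mul_right_right.of_mul_right_right.symm
  have par : ∀ f : BQF, f.disc = Δ → ∃ β, f.b = Δ % 2 + 2 * β := by
    intro f hf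
    refine ⟨f.b / 2, ?_⟩
    have : Δ % 2 = f.b % 2 := by
      rw [← hf, BQF.disc, sub_eq_add_neg,
        show -(4 * f.a * f.c) = 2 * (-(2 * f.a * f.c)) by ring, Int.add_mul_emod_self_left]
      rcases Int.emod_two_eq_zero_or_one f.b with h | h <;> simp [pow_two, Int.mul_emod, h]
    omega
  obtain ⟨β₁, e₁⟩ := par f₁ d₁
  obtain ⟨β₂, e₂⟩ := par f₂ d₂
  obtain ⟨β₃, e₃⟩ := par f₃ d₃
  obtain ⟨t, r, s, w, hr, hs, hw⟩ := exists_crt (x := β₁) (y := β₂) (z := β₃) k12 k13 k23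
  have q₁ := BQF.equivalent_shift f₁ r
  have q₂ := BQF.equivalent_shift f₂ s
  have q₃ := BQF.equivalent_shift f₃ w
  rw [show f₁.b + 2 * f₁.a * r = Δ % 2 + 2 * t by rw [e₁, hr]; ring] at q₁
  rw [show f₂.b + 2 * f₂.a * s = Δ % 2 + 2 * t by rw [e₂, hs]; ring] at q₂
  rw [show f₃.b + 2 * f₃.a * w = Δ % 2 + 2 * t by rw [e₃, hw]; ring] at q₃
  have D₁ := q₁.disc_eq.trans d₁
  have D₂ := q₂.disc_eq.trans d₂
  have D₃ := q₃.disc_eq.trans d₃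
  generalize f₁.a * r ^ 2 + f₁.b * r + f₁.c = z₁ at *
  generalize f₂.a * s ^ 2 + f₂.b * s + f₂.c = z₂ at *
  generalize f₃.a * w ^ 2 + f₃.b * w + f₃.c = z₃ at *
  have E12 : f₁.a * z₁ = f₂.a * z₂ := by
    have := D₁.trans D₂.symm
    simp only [BQF.disc] at this
    have h4 : 4 * (f₁.a * z₁) = 4 * (f₂.a * z₂) := by linear_combination -this
    omega
  have E13 : f₁.a * z₁ = f₃.a * z₃ := by
    have := D₁.trans D₃.symm
    simp only [BQF.disc] at this
    have h4 : 4 * (f₁.a * z₁) = 4 * (f₃.a * z₃) := by linear_combination -this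
    omega
  have dv2 : f₂.a ∣ z₁ := k12.symm.dvd_of_dvd_mul_left ⟨z₂, E12⟩
  have dv3 : f₃.a ∣ z₁ := k13.symm.dvd_of_dvd_mul_left ⟨z₃, E13⟩
  obtain ⟨C, hC⟩ := k23.mul_dvd dv2 dv3
  have hC2 : z₂ = f₁.a * f₃.a * C := by
    apply mul_left_cancel₀ n₂
    rw [← E12, hC]; ring
  have hC3 : z₃ = f₁.a * f₂.a * C := by
    apply mul_left_cancel₀ n₃
    rw [← E13, hC]; ring
  subst hC hC2 hC3
  exact ⟨f₁.a, f₂.a, f₃.a, Δ % 2 + 2 * t, C, D₁, q₁.isPrimitive p₁, D₂, q₂.isPrimitive p₂,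
    D₃, q₃.isPrimitive p₃, mk_eq_mk.2 q₁, mk_eq_mk.2 q₂, mk_eq_mk.2 q₃⟩

theorem exists_isTriple (C D : FormClass Δ) : ∃ E, IsTriple C D E := by
  obtain ⟨a₁, a₂, a₃, B, Z, d₁, h₁, d₂, h₂, d₃, h₃, rfl, rfl, -⟩ := exists_concordant C D D
  have x₁ : (⟨a₁, B, a₂ * a₃ * Z⟩ : BQF) = ⟨a₁, B, a₂ * (a₃ * Z)⟩ := by rw [mul_assoc]
  have x₂ : (⟨a₂, B, a₁ * a₃ * Z⟩ : BQF) = ⟨a₂, B, a₁ * (a₃ * Z)⟩ := by rw [mul_assoc]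
  have key := isTriple_dirichlet (x₁ ▸ d₁) (x₁ ▸ h₁) (x₂ ▸ d₂) (x₂ ▸ h₂)
    (by rw [← d₁]; simp only [BQF.disc]; ring)
  simp only [← x₁, ← x₂] at key
  exact ⟨_, key⟩

/-- Gauss composition: `C * D` is the class such that the two factors and its inverse are the
classes of the three forms of a cube, i.e. `[Q₁] * [Q₂] * [Q₃] = 1` for every cube. -/
noncomputable instance : Mul (FormClass Δ) where
  mul C D := (Classical.choose (exists_isTriple C D))⁻¹

theorem IsTriple.mul_eq {C D E : FormClass Δ} (h : IsTriple C D E) : C * D = E⁻¹ :=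
  congrArg (·⁻¹) ((Classical.choose_spec (exists_isTriple C D)).unique h)

/-- Dirichlet's composition of two forms with a common middle coefficient. -/
theorem mk_mul_mk {f₁ f₂ f₃ : BQF} (d₁ : f₁.disc = Δ) (h₁ : f₁.IsPrimitive)
    (d₂ : f₂.disc = Δ) (h₂ : f₂.IsPrimitive) (d₃ : f₃.disc = Δ) (h₃ : f₃.IsPrimitive)
    (C : ℤ) (e₁ : f₁ = ⟨f₁.a, f₁.b, f₂.a * C⟩) (e₂ : f₂ = ⟨f₂.a, f₁.b, f₁.a * C⟩)
    (e₃ : f₃ = ⟨f₁.a * f₂.a, f₁.b, C⟩) :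
    mk f₁ d₁ h₁ * mk f₂ d₂ h₂ = mk f₃ d₃ h₃ := by
  obtain ⟨a₁, B, c₁⟩ := f₁
  obtain ⟨a₂, b₂, c₂⟩ := f₂
  simp only [BQF.mk.injEq, true_and] at e₁ e₂ e₃
  obtain ⟨rfl, rfl⟩ := e₂
  subst e₁ e₃
  rw [(isTriple_dirichlet d₁ h₁ d₂ h₂ d₃).mul_eq, inv_inv']

/-- The principal form `x² - (Δ/4) y²` or `x² + x y - ((Δ-1)/4) y²`. -/
def principal (Δ : ℤ) : BQF := ⟨1, Δ % 4, (Δ % 4 - Δ) / 4⟩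

theorem disc_principal (hΔ : Δ % 4 = 0 ∨ Δ % 4 = 1) : (principal Δ).disc = Δ := by
  rcases hΔ with h | h <;> simp only [BQF.disc, principal, h] <;> omega

theorem isPrimitive_principal (Δ : ℤ) : (principal Δ).IsPrimitive :=
  (BQF.isPrimitive_iff _).2 ⟨1, 0, 0, by simp [principal]⟩

theorem principal_equivalent (hΔ : Δ % 4 = 0 ∨ Δ % 4 = 1) {b c : ℤ}
    (h : (⟨1, b, c⟩ : BQF).disc = Δ) : BQF.Equivalent (principal Δ) ⟨1, b, c⟩ := by
  have hd := disc_principal hΔ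
  have hs := BQF.equivalent_shift (principal Δ) ((b - Δ % 4) / 2)
  have hp : (b - Δ % 4) % 2 = 0 := by
    have h' : Δ = b * b - 4 * c := by rw [← h]; simp only [BQF.disc]; ring
    have : (b * b) % 2 = b % 2 := by
      rcases Int.emod_two_eq_zero_or_one b with h | h <;> simp [Int.mul_emod, h]
    omega
  have hb : (principal Δ).b + 2 * (principal Δ).a * ((b - Δ % 4) / 2) = b := by
    simp only [principal]; omega
  have hD := hs.disc_eq.trans hd
  rw [hb] at hs hD
  generalize (principal Δ).a * ((b - Δ % 4) / 2) ^ 2 + (principal Δ).b * ((b - Δ % 4) / 2)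
    + (principal Δ).c = z at *
  have : z = c := by
    have := hD.trans h.symm
    simp only [BQF.disc, principal] at this
    omega
  rw [this] at hs
  exact hs

/-- For `Δ ≡ 0, 1 (mod 4)`, composition makes `Cl(Δ)` an abelian group, with the class of the
principal form as identity. -/
noncomputable instance [hΔ : Fact (Δ % 4 = 0 ∨ Δ % 4 = 1)] : CommGroup (FormClass Δ) where
  one := mk (principal Δ) (disc_principal hΔ.out) (isPrimitive_principal Δ)
  mul_assoc C₁ C₂ C₃ := by
    obtain ⟨a₁, a₂, a₃, B, Z, d₁, h₁, d₂, h₂, d₃, h₃, rfl, rfl, rfl⟩ := exists_concordant C₁ C₂ C₃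
    have p₁₂ : (⟨a₁ * a₂, B, a₃ * Z⟩ : BQF).IsPrimitive :=
      coeff_dirichlet (by rw [← mul_assoc]; exact h₁) (by rw [← mul_assoc]; exact h₂)
    have p₂₃ : (⟨a₂ * a₃, B, a₁ * Z⟩ : BQF).IsPrimitive :=
      coeff_dirichlet (by rw [← mul_assoc, mul_comm a₃]; exact h₂)
        (by rw [← mul_assoc, mul_comm a₂]; exact h₃)
    have p : (⟨a₁ * a₂ * a₃, B, Z⟩ : BQF).IsPrimitive := coeff_dirichlet p₁₂ h₃
    have hD : B ^ 2 - 4 * a₁ * (a₂ * a₃ * Z) = Δ := d₁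
    rw [mk_mul_mk d₁ h₁ d₂ h₂ (f₃ := ⟨a₁ * a₂, B, a₃ * Z⟩) (by simp only [BQF.disc]; rw [← hD]; ring)
        p₁₂ (a₃ * Z) (by simp [mul_assoc]) (by simp [mul_assoc]) rfl,
      mk_mul_mk _ p₁₂ d₃ h₃ (f₃ := ⟨a₁ * a₂ * a₃, B, Z⟩) (by simp only [BQF.disc]; rw [← hD]; ring)
        p Z rfl rfl rfl,
      mk_mul_mk d₂ h₂ d₃ h₃ (f₃ := ⟨a₂ * a₃, B, a₁ * Z⟩) (by simp only [BQF.disc]; rw [← hD]; ring)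
        p₂₃ (a₁ * Z) (by ext <;> simp; ring) (by ext <;> simp; ring) rfl,
      mk_mul_mk d₁ h₁ _ p₂₃ (f₃ := ⟨a₁ * a₂ * a₃, B, Z⟩) (by simp only [BQF.disc]; rw [← hD]; ring)
        p Z rfl rfl (by simp [mul_assoc])]
  one_mul C := by
    obtain ⟨⟨a, b, c⟩, hf, hf', rfl⟩ := exists_rep C
    have hd : (⟨1, b, a * c⟩ : BQF).disc = Δ := by rw [← hf]; simp only [BQF.disc]; ring
    have he := principal_equivalent hΔ.out hd
    change mk (principal Δ) _ _ * _ = _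
    rw [mk_eq_of_equivalent _ _ he]
    exact mk_mul_mk _ _ _ _ _ _ c rfl (by simp) (by simp)
  mul_one C := by
    obtain ⟨⟨a, b, c⟩, hf, hf', rfl⟩ := exists_rep C
    have hd : (⟨1, b, a * c⟩ : BQF).disc = Δ := by rw [← hf]; simp only [BQF.disc]; ring
    have he := principal_equivalent hΔ.out hd
    change _ * mk (principal Δ) _ _ = _
    rw [mk_eq_of_equivalent _ _ he]
    exact mk_mul_mk _ _ _ _ _ _ c (by simp) rfl (by simp)
  inv_mul_cancel C := by
    obtain ⟨⟨a, b, c⟩, hf, hf', rfl⟩ := exists_rep C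
    have h1 : BQF.Equivalent ⟨a, -b, c⟩ ⟨c, b, a⟩ := by
      simpa using BQF.equivalent_flip ⟨a, -b, c⟩
    have hd : (⟨1, -b, c * a⟩ : BQF).disc = Δ := by rw [← hf]; simp only [BQF.disc]; ring
    have h2 : BQF.Equivalent ⟨c * a, b, 1⟩ (principal Δ) :=
      (BQF.equivalent_flip ⟨c * a, b, 1⟩).trans (principal_equivalent hΔ.out hd).symm
    have hpr := h2.symm.isPrimitive (isPrimitive_principal Δ)
    have hdr := h2.symm.disc_eq.trans (disc_principal hΔ.out)
    rw [inv_mk, mk_eq_of_equivalent _ _ h1]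
    change _ = mk (principal Δ) _ _
    rw [← mk_eq_of_equivalent hdr hpr h2]
    exact mk_mul_mk _ _ _ _ _ _ 1 (by simp) (by simp) rfl
  mul_comm C D := by
    obtain ⟨a₁, a₂, a₃, B, Z, d₁, h₁, d₂, h₂, d₃, h₃, rfl, rfl, -⟩ := exists_concordant C D D
    have p₁₂ : (⟨a₁ * a₂, B, a₃ * Z⟩ : BQF).IsPrimitive :=
      coeff_dirichlet (by rw [← mul_assoc]; exact h₁) (by rw [← mul_assoc]; exact h₂)
    have hD : B ^ 2 - 4 * a₁ * (a₂ * a₃ * Z) = Δ := d₁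
    rw [mk_mul_mk d₁ h₁ d₂ h₂ (f₃ := ⟨a₁ * a₂, B, a₃ * Z⟩) (by simp only [BQF.disc]; rw [← hD]; ring)
        p₁₂ (a₃ * Z) (by simp [mul_assoc]) (by simp [mul_assoc]) rfl,
      mk_mul_mk d₂ h₂ d₁ h₁ (f₃ := ⟨a₁ * a₂, B, a₃ * Z⟩) (by simp only [BQF.disc]; rw [← hD]; ring)
        p₁₂ (a₃ * Z) (by simp [mul_assoc]) (by simp [mul_assoc]) (by simp [mul_comm])]

/-- The law characterizing composition: the three classes of a cube multiply to the identity. -/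
theorem IsTriple.mul_mul_eq_one [Fact (Δ % 4 = 0 ∨ Δ % 4 = 1)] {C D E : FormClass Δ}
    (h : IsTriple C D E) : C * D * E = 1 := by
  rw [h.mul_eq, inv_mul_cancel]

end FormClass

/-- A binary quadratic diform `a x² + b √σ x y + c y²` with `a, b, c ∈ ℤ`. -/
@[ext]
structure Diform (σ : ℤ) where
  a : ℤ
  b : ℤ
  c : ℤ

namespace Diform

variable {σ : ℤ}

/-- The value of a diform at a pair of elements of `ℤ[√σ]`. -/
def eval (Q : Diform σ) (x y : Zsqrtd σ) : Zsqrtd σ :=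
  (Q.a : Zsqrtd σ) * x ^ 2 + (Q.b : Zsqrtd σ) * Zsqrtd.sqrtd * x * y + (Q.c : Zsqrtd σ) * y ^ 2

/-- The discriminant `σ (b² σ - 4 a c)`. -/
def disc (Q : Diform σ) : ℤ := σ * (Q.b ^ 2 * σ - 4 * Q.a * Q.c)

/-- The restriction of `Q` to red divectors `(u, v √σ)`. -/
def red (Q : Diform σ) : BQF := ⟨Q.a, Q.b * σ, Q.c * σ⟩

/-- The restriction of `Q` to blue divectors `(u √σ, v)`. -/
def blue (Q : Diform σ) : BQF := ⟨Q.a * σ, Q.b * σ, Q.c⟩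

theorem eval_red (Q : Diform σ) (u v : ℤ) :
    ((Q.red.eval u v : ℤ) : Zsqrtd σ) = Q.eval u ((v : Zsqrtd σ) * Zsqrtd.sqrtd) := by
  have h : (Zsqrtd.sqrtd * Zsqrtd.sqrtd : Zsqrtd σ) = σ := Zsqrtd.dmuld
  simp only [red, BQF.eval, eval]
  push_cast
  linear_combination (-(Q.b * u * v : Zsqrtd σ) - Q.c * v ^ 2) * h

theorem eval_blue (Q : Diform σ) (u v : ℤ) :
    ((Q.blue.eval u v : ℤ) : Zsqrtd σ) = Q.eval ((u : Zsqrtd σ) * Zsqrtd.sqrtd) v := by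
  have h : (Zsqrtd.sqrtd * Zsqrtd.sqrtd : Zsqrtd σ) = σ := Zsqrtd.dmuld
  simp only [blue, BQF.eval, eval]
  push_cast
  linear_combination (-(Q.b * u * v : Zsqrtd σ) - Q.a * u ^ 2) * h

theorem disc_red (Q : Diform σ) : Q.red.disc = Q.disc := by
  simp only [red, BQF.disc, disc]; ring

theorem disc_blue (Q : Diform σ) : Q.blue.disc = Q.disc := by
  simp only [blue, BQF.disc, disc]; ring

theorem dvd_disc (Q : Diform σ) : σ ∣ Q.disc := Dvd.intro _ rfl

end Diform

/-- The form `A_Δ`: it is `σ u² - Δ/(4σ) v²` if `Δ/σ ≡ 0 (mod 4)`, and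
`σ u² + σ u v - (Δ - σ²)/(4σ) v²` otherwise. All divisions are exact when `σ ∈ {2, 3}` divides
the discriminant `Δ`. -/
def formA (σ Δ : ℤ) : BQF :=
  if 4 ∣ Δ / σ then ⟨σ, 0, -(Δ / (4 * σ))⟩ else ⟨σ, σ, -((Δ - σ ^ 2) / (4 * σ))⟩

theorem disc_formA {σ Δ : ℤ} (hσ : σ = 2 ∨ σ = 3) (hdvd : σ ∣ Δ) {f : BQF} (hf : f.disc = Δ) :
    (formA σ Δ).disc = Δ := by
  have h4 : Δ % 4 = 0 ∨ Δ % 4 = 1 := by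
    have h' : Δ = f.b * f.b - 4 * (f.a * f.c) := by rw [← hf]; simp only [BQF.disc]; ring
    have : (f.b * f.b) % 4 = 0 ∨ (f.b * f.b) % 4 = 1 := by
      have : f.b % 4 = 0 ∨ f.b % 4 = 1 ∨ f.b % 4 = 2 ∨ f.b % 4 = 3 := by omega
      rcases this with h | h | h | h <;> simp [Int.mul_emod, h]
    omega
  unfold formA
  rcases hσ with rfl | rfl <;> split_ifs with h <;> simp only [BQF.disc] <;> norm_num <;> omega

/-! The theorem is one Dirichlet composition read in two directions. Put B = -bσ. Flipping by (x, y)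
↦ (-y, x) turns the blue form into (c, B, σa) and the red form into (σc, B, a), while A_Δ is
properly equivalent to (σ, B, ca). These three are concordant: (σ, B, c·a) composed with (c, B, σ·a)
is (σc, B, a). Thus [red] = [A_Δ][blue] for every diform for which the three forms are primitive.
The coprimality in the first half serves only to ensure primitivity.

That A_Δ is equivalent to (σ, B, ca) is `formA_equivalent`. A form (σ, σk, m) can be shifted to
change k by any even number, and the parity of k is read off from Δ/σ modulo 4, which is exactly the
case distinction in A_Δ.

For the converse it suffices to realise [Q₂] as a blue class, since the identity then forces the red
class to be [A_Δ][Q₂] = [Q₁]. A blue form is one whose first two coefficients are divisible by σ.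
Represent Q₂ with leading coefficient prime to σ and make it concordant with A_Δ
(`BQF.exists_concordant_shift`): its middle coefficient becomes that of a shift of A_Δ, hence a
multiple of σ, and its last coefficient becomes a multiple of σ as well. Flipping gives a blue form.
-/

/-! ### Forms with leading coefficient σ -/

/-- The difference of the squared middle coefficients is a multiple of 4, and its two factors differ
by `2 * g.b`, so if either is even then both are. -/
theorem BQF.even_sub_b {f g : BQF} (h : f.disc = g.disc) : ∃ k, f.b - g.b = 2 * k := by
  have h2 : Even ((f.b - g.b) * (f.b + g.b)) :=
    ⟨2 * (f.a * f.c - g.a * g.c), by simp only [disc] at h; linear_combination h⟩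
  obtain ⟨k, hk⟩ | ⟨k, hk⟩ := Int.even_mul.1 h2
  · exact ⟨k, by omega⟩
  · exact ⟨k - g.b, by omega⟩

/-- Every form `(σ, σ k, m)` is properly equivalent to `A_Δ`, where `Δ` is its discriminant. -/
theorem formA_equivalent {σ : ℤ} (hσ : σ = 2 ∨ σ = 3) (k m : ℤ) {Δ : ℤ}
    (hΔ : (⟨σ, σ * k, m⟩ : BQF).disc = Δ) : BQF.Equivalent (formA σ Δ) ⟨σ, σ * k, m⟩ := by
  have hσ0 : σ ≠ 0 := by rcases hσ with rfl | rfl <;> norm_num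
  have hdvd : σ ∣ Δ := ⟨σ * k ^ 2 - 4 * m, by rw [← hΔ]; simp only [BQF.disc]; ring⟩
  have hdA := disc_formA hσ hdvd hΔ
  have hquot : Δ / σ = σ * k ^ 2 - 4 * m :=
    Int.ediv_eq_of_eq_mul_right hσ0 (by rw [← hΔ]; simp only [BQF.disc]; ring)
  obtain ⟨t, ha, hb⟩ : ∃ t, (formA σ Δ).a = σ ∧ (formA σ Δ).b + 2 * σ * t = σ * k := by
    unfold formA
    rw [hquot]
    -- The parity of k selects the branch of `formA`. For k odd, Δ/σ is congruent to σ modulo 4,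
    -- which is nonzero because σ is 2 or 3. In both cases t is half of k, rounded down.
    rcases Int.even_or_odd' k with ⟨j, rfl | rfl⟩
    · rw [if_pos ⟨σ * j ^ 2 - m, by ring⟩]
      exact ⟨j, rfl, by ring⟩
    · rw [if_neg]
      · exact ⟨j, rfl, by ring⟩
      · have e : σ * (2 * j + 1) ^ 2 - 4 * m = 4 * (σ * (j ^ 2 + j) - m) + σ := by ring
        rw [e]
        rcases hσ with rfl | rfl <;> omega
  have hs := BQF.equivalent_shift (formA σ Δ) t
  rw [ha, hb] at hs
  have hd := (hs.disc_eq.trans hdA).trans hΔ.symm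
  simp only [BQF.disc] at hd
  -- The first two coefficients already agree and the leading one is nonzero, so equal discriminants
  -- force equal last coefficients.
  rwa [mul_left_cancel₀ (mul_ne_zero four_ne_zero hσ0) (sub_right_injective hd)] at hs

/-! ### Making two forms concordant -/

/-- Two forms whose leading coefficients are coprime can be shifted to be concordant. -/
theorem BQF.exists_concordant_shift {f g : BQF} (hd : f.disc = g.disc) (hfa : f.a ≠ 0)
    (hc : IsCoprime g.a f.a) : ∃ s C : ℤ,
      Equivalent f ⟨f.a, f.b + 2 * f.a * s, g.a * C⟩ ∧
      Equivalent g ⟨g.a, f.b + 2 * f.a * s, f.a * C⟩ := by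
  obtain ⟨k, hk⟩ := even_sub_b hd
  obtain ⟨u, v, huv⟩ := hc
  -- Multiplying the Bézout relation by 2k splits `f.b - g.b = 2 * k` into a multiple of `2 * g.a`
  -- plus a multiple of `2 * f.a`; each form absorbs its own share by a shift.
  have hf := equivalent_shift f (-v * k)
  have hg := equivalent_shift g (u * k)
  rw [show g.b + 2 * g.a * (u * k) = f.b + 2 * f.a * (-v * k) by
    linear_combination 2 * k * huv - hk] at hg
  have hD := (hf.disc_eq.trans hd).trans hg.disc_eq.symm
  generalize f.a * (-v * k) ^ 2 + f.b * (-v * k) + f.c = m at *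
  generalize g.a * (u * k) ^ 2 + g.b * (u * k) + g.c = e at *
  -- With a common middle coefficient, equal discriminants give equal products of outer
  -- coefficients. Coprimality then produces the common factor C.
  have hm : f.a * m = g.a * e := by
    simp only [disc] at hD
    have : 4 * (f.a * m) = 4 * (g.a * e) := by linear_combination -hD
    omega
  obtain ⟨C, rfl⟩ : f.a ∣ e := IsCoprime.dvd_of_dvd_mul_left
    ⟨v, u, by linear_combination huv⟩ ⟨m, hm.symm⟩
  obtain rfl : m = g.a * C := mul_left_cancel₀ hfa (by rw [hm]; ring)
  exact ⟨_, C, hf, hg⟩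

/-! ### The composition identity for a diform -/

namespace Diform

variable {σ : ℤ}

/-- The sign of the middle coefficient is chosen to match the flipped red and blue forms, so that
all three become concordant. -/
theorem formA_disc_equivalent (hσ : σ = 2 ∨ σ = 3) (Q : Diform σ) :
    BQF.Equivalent (formA σ Q.disc) ⟨σ, -(Q.b * σ), Q.c * Q.a⟩ := by
  have h := formA_equivalent hσ (-Q.b) (Q.c * Q.a) (Δ := Q.disc)
    (by simp only [BQF.disc, disc]; ring)
  rwa [show σ * -Q.b = -(Q.b * σ) by ring] at h

/-- A prime dividing σc, bσ and a divides σ or c. In the first case it divides every coefficient of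
(σ, -bσ, ca), which is equivalent to A_Δ; in the second, every coefficient of the blue form. -/
theorem isPrimitive_red (hσ : σ = 2 ∨ σ = 3) (Q : Diform σ) (hA : (formA σ Q.disc).IsPrimitive)
    (hb : Q.blue.IsPrimitive) : Q.red.IsPrimitive := by
  have hc : (⟨Q.c, -(Q.b * σ), σ * Q.a⟩ : BQF).IsPrimitive := by
    rw [mul_comm σ Q.a]
    exact (BQF.equivalent_flip Q.blue).isPrimitive hb
  refine (BQF.equivalent_flip Q.red).symm.isPrimitive ?_
  have := FormClass.coeff_dirichlet ((Q.formA_disc_equivalent hσ).isPrimitive hA) hc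
  rwa [mul_comm] at this

/-- `[Q_red] = [A_Δ] [Q_blue]`, as soon as the three forms are primitive. -/
theorem mk_red_eq_mul {Δ : ℤ} (hσ : σ = 2 ∨ σ = 3) (Q : Diform σ) (hΔ : Q.disc = Δ)
    (dr : Q.red.disc = Δ) (hr : Q.red.IsPrimitive) (db : Q.blue.disc = Δ)
    (hb : Q.blue.IsPrimitive) (dA : (formA σ Δ).disc = Δ) (hA : (formA σ Δ).IsPrimitive) :
    FormClass.mk Q.red dr hr = FormClass.mk (formA σ Δ) dA hA * FormClass.mk Q.blue db hb := by
  subst hΔ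
  rw [FormClass.mk_eq_of_equivalent dr hr (BQF.equivalent_flip _),
    FormClass.mk_eq_of_equivalent db hb (BQF.equivalent_flip _),
    FormClass.mk_eq_of_equivalent dA hA (Q.formA_disc_equivalent hσ)]
  -- The common factor in Dirichlet's composition is a: (σ, B, c·a) and (c, B, σ·a) compose to (σc,
  -- B, a), where B = -bσ.
  refine (FormClass.mk_mul_mk _ _ _ _ _ _ Q.a rfl ?_ ?_).symm
  · ext <;> simp only [blue] <;> ring
  · ext <;> simp only [red, blue] <;> ring

end Diform

/-! ### Both directions of the theorem -/

theorem mainTheorem4 (σ : ℤ) (hσ : σ = 2 ∨ σ = 3) :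
    (∀ Q : Diform σ, IsCoprime Q.a (Q.b * σ) → IsCoprime (Q.b * σ) Q.c → IsCoprime Q.a Q.c →
      ∃ (hr : Q.red.IsPrimitive) (hb : Q.blue.IsPrimitive) (hA : (formA σ Q.disc).IsPrimitive),
        FormClass.mk Q.red Q.disc_red hr =
          FormClass.mk (formA σ Q.disc) (disc_formA hσ Q.dvd_disc Q.disc_red) hA *
            FormClass.mk Q.blue Q.disc_blue hb) ∧
    (∀ (Δ : ℤ) (hdvd : σ ∣ Δ) (Q₁ Q₂ : BQF)
      (h₁ : Q₁.disc = Δ) (hp₁ : Q₁.IsPrimitive) (h₂ : Q₂.disc = Δ) (hp₂ : Q₂.IsPrimitive)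
      (hA : (formA σ Δ).IsPrimitive),
      FormClass.mk Q₁ h₁ hp₁ =
          FormClass.mk (formA σ Δ) (disc_formA hσ hdvd h₁) hA * FormClass.mk Q₂ h₂ hp₂ →
      ∃ (Q : Diform σ) (hr : Q.red.disc = Δ) (hpr : Q.red.IsPrimitive)
        (hb : Q.blue.disc = Δ) (hpb : Q.blue.IsPrimitive),
        FormClass.mk Q.red hr hpr = FormClass.mk Q₁ h₁ hp₁ ∧
        FormClass.mk Q.blue hb hpb = FormClass.mk Q₂ h₂ hp₂) := by
  refine ⟨fun Q hab hbc hac => ?_, fun Δ hdvd Q₁ Q₂ h₁ hp₁ h₂ hp₂ hA h => ?_⟩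
  · have hr : Q.red.IsPrimitive := by
      obtain ⟨u, v, huv⟩ := hab
      exact (BQF.isPrimitive_iff _).2 ⟨u, v, 0, by simp only [Diform.red]; linear_combination huv⟩
    have hb : Q.blue.IsPrimitive := by
      obtain ⟨u, v, huv⟩ := hbc
      exact (BQF.isPrimitive_iff _).2 ⟨0, u, v, by simp only [Diform.blue]; linear_combination huv⟩
    have hA : (formA σ Q.disc).IsPrimitive := by
      -- Since bσ is coprime to both c and a, it is coprime to ca, so (σ, -bσ, ca) is primitive, and
      -- hence A_Δ is too.
      obtain ⟨u, v, huv⟩ := hbc.mul_right hab.symm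
      exact (Q.formA_disc_equivalent hσ).symm.isPrimitive
        ((BQF.isPrimitive_iff _).2 ⟨0, -u, v, by linear_combination huv⟩)
    exact ⟨hr, hb, hA, Q.mk_red_eq_mul hσ rfl _ _ _ _ _ _⟩
  · have hσ0 : σ ≠ 0 := by rcases hσ with rfl | rfl <;> norm_num
    have ha : (formA σ Δ).a = σ := by unfold formA; split_ifs <;> rfl
    obtain ⟨β, hβ⟩ : σ ∣ (formA σ Δ).b := by unfold formA; split_ifs <;> simp
    obtain ⟨g, hg, hgc⟩ := Q₂.exists_coprime_rep hp₂ σ hσ0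
    -- A_Δ takes the role of f so that the common middle coefficient has the form σβ + 2σs, a
    -- multiple of σ. Only the shift of g is kept, as the composition identity for diforms recovers
    -- the statement about A_Δ.
    obtain ⟨s, C, -, hgC⟩ := BQF.exists_concordant_shift (f := formA σ Δ) (g := g)
      ((disc_formA hσ hdvd h₁).trans (hg.disc_eq.trans h₂).symm) (by rwa [ha]) (by rwa [ha])
    rw [ha, hβ] at hgC
    -- Q₂ is now equivalent to (g.a, σ(β + 2s), σC); its flip (σC, -σ(β + 2s), g.a) has the shape of
    -- a blue form, from which the diform is read off.
    have hblue : BQF.Equivalent Q₂ (⟨C, -(β + 2 * s), g.a⟩ : Diform σ).blue := by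
      convert (hg.trans hgC).trans (BQF.equivalent_flip _) using 1
      ext <;> simp only [Diform.blue] <;> ring
    -- From here only the blue class matters: it fixes the discriminant, and together with A_Δ it
    -- determines the red class.
    generalize (⟨C, -(β + 2 * s), g.a⟩ : Diform σ) = Q at hblue
    have hb := hblue.disc_eq.trans h₂
    have hpb := hblue.isPrimitive hp₂
    have hQ : Q.disc = Δ := Q.disc_blue.symm.trans hb
    have hpr : Q.red.IsPrimitive := Q.isPrimitive_red hσ (by rwa [hQ]) hpb
    have hr : Q.red.disc = Δ := Q.disc_red.trans hQ
    have hblue' := (FormClass.mk_eq_of_equivalent h₂ hp₂ hblue).symm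
    exact ⟨Q, hr, hpr, hb, hpb, by rw [Q.mk_red_eq_mul hσ hQ hr hpr hb hpb _ hA, h, hblue'], hblue'⟩
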